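/- A \emph{median algebra} is a set $M$ with a map $\mu : M^3\to M$ such that $\mu(x,y,y)=y$, $\mu(x,y,z)=\mu(z,x,y)=\mu(x,z,y)$ and $\mu(\mu(x,w,y),w,z)=\mu(x,w,\mu(y,w,z))$. The interval between $x$ and $y$ is $I(x,y)=\{z \mid \mu(x,y,z)=z\}$, and $M$ is \emph{discrete} if all intervals are finite. A subset is \emph{convex} if it contains $I(x,y)$ for all its points $x,y$; a \emph{wall} is a partition of $M$ into two non-empty convex subsets, called \emph{halfspaces}. An \emph{orientation} is a set of halfspaces which contains exactly one halfspace of each wall and which contains every halfspace $B$ such that $A\subset B$ for one of its elements $A$. For instance, every $x \in M$ defines the \emph{principal} orientation of all halfspaces containing $x$. The \emph{cubulation} $X$ of a discrete median algebra $M$ is the CAT(0) cube complex whose vertices are the orientations that have finite symmetric difference with a principal orientation, whose edges join two orientations when their symmetric difference has exactly two elements, and whose $n$-cubes fill in the subgraphs isomorphic to the one-skeleton of an $n$-cube; the dimension of $M$ is that of $X$. The \emph{Roller compactification} $\overline{M}$ is the set of all orientations; it is a median algebra, the median of three orientations being the set of halfspaces contained in at least two of them. The \emph{Roller boundary} is the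 set of the orientations which are not vertices of $X$. A \emph{median flat} is a non-empty, finite-dimensional, discrete median algebra $M$ such that, for some points $\zeta,\xi$ of its Roller boundary, all principal orientations lie in the interval $I(\zeta,\xi)$ of $\overline{M}$. Let $X$ be the cubulation of a median flat, and let $\mathrm{Isom}(X)$ be the group of isometries of the vertex set of $X$ with respect to the graph metric of its one-skeleton. An isometry, or a subgroup of $\mathrm{Isom}(X)$, is \emph{$X$-elliptic} if its orbits in $X$ are bounded, and a subgroup is \emph{locally $X$-elliptic} if all its finitely generated subgroups are $X$-elliptic. \textbf{Proposition.} There exist a finite-index subgroup $\mathrm{Isom}_0(X)\leq \mathrm{Isom}(X)$, an integer $n\geq 1$ and a homomorphism $\beta : \mathrm{Isom}_0(X)\to\mathbb{Z}^n$ such that $$\ker(\beta)=\{g\in \mathrm{Isom}_0(X)\mid g \text{ is } X\text{-elliptic}\}.$$ In particular, $\ker(\beta)$ is locally $X$-elliptic. -/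

import Mathlib

/-- A median algebra: a set with a ternary operation satisfying the majority, symmetry and
associativity laws. -/
class MedianAlgebra (M : Type*) where
  /-- the median operation -/
  med : M → M → M → M
  med_self : ∀ x y, med x y y = y
  med_rotate : ∀ x y z, med x y z = med z x y
  med_swap : ∀ x y z, med x y z = med x z y
  med_assoc : ∀ x y z w, med (med x w y) w z = med x w (med y w z)

namespace MedianAlgebra

section Basic

variable {M : Type*} [MedianAlgebra M]

/-- The interval `I(x,y)`. -/
def interval (x y : M) : Set M := {z | med x y z = z}

/-- A subset is convex if it contains the interval between any two of its points. -/
def IsConvex (Y : Set M) : Prop := ∀ x ∈ Y, ∀ y ∈ Y, interval x y ⊆ Y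

/-- The two sides of a wall: `H` and its complement are convex and non-empty. -/
structure IsHalfspace (H : Set M) : Prop where
  convex : IsConvex H
  convex_compl : IsConvex Hᶜ
  nonempty : H.Nonempty
  nonempty_compl : Hᶜ.Nonempty

theorem IsHalfspace.compl {H : Set M} (h : IsHalfspace H) : IsHalfspace Hᶜ :=
  ⟨h.convex_compl, by rw [compl_compl]; exact h.convex, h.nonempty_compl,
    by rw [compl_compl]; exact h.nonempty⟩

end Basic

/-- A median algebra is discrete if all its intervals are finite. -/
def IsDiscrete (M : Type*) [MedianAlgebra M] : Prop :=
  ∀ x y : M, (interval x y).Finite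

/-- An orientation: a coherent choice of one side of each wall of `M`. The type `Orientation M`
of all the orientations is (the vertex set of) the Roller compactification. -/
@[ext]
structure Orientation (M : Type*) [MedianAlgebra M] where
  /-- the collection of the chosen halfspaces -/
  carrier : Set (Set M)
  isHalfspace : ∀ H ∈ carrier, IsHalfspace H
  mem_or_compl_mem : ∀ H, IsHalfspace H → H ∈ carrier ∨ Hᶜ ∈ carrier
  not_mem_and_compl_mem : ∀ H, ¬ (H ∈ carrier ∧ Hᶜ ∈ carrier)
  mem_of_subset : ∀ A B, IsHalfspace A → IsHalfspace B → A ⊆ B → A ∈ carrier → B ∈ carrier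

namespace Orientation

variable {M : Type*} [MedianAlgebra M]

/-- The principal orientation defined by a point. -/
def principal (x : M) : Orientation M where
  carrier := {H | IsHalfspace H ∧ x ∈ H}
  isHalfspace _ h := h.1
  mem_or_compl_mem H h := by
    by_cases hx : x ∈ H
    · exact Or.inl ⟨h, hx⟩
    · exact Or.inr ⟨h.compl, hx⟩
  not_mem_and_compl_mem _ h := h.2.2 h.1.2
  mem_of_subset _ _ _ hB hAB hA := ⟨hB, hAB hA.2⟩

/-- Two orientations are commensurable if their symmetric difference is finite. -/
def Commensurable (σ τ : Orientation M) : Prop := (symmDiff σ.carrier τ.carrier).Finite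

/-- The median of three orientations: the halfspaces belonging to at least two of them. -/
def maj (σ τ ρ : Orientation M) : Orientation M where
  carrier := {H | (H ∈ σ.carrier ∧ H ∈ τ.carrier) ∨ (H ∈ τ.carrier ∧ H ∈ ρ.carrier) ∨
    (H ∈ σ.carrier ∧ H ∈ ρ.carrier)}
  isHalfspace H h := by
    rcases h with h | h | h
    exacts [σ.isHalfspace H h.1, τ.isHalfspace H h.1, σ.isHalfspace H h.1]
  mem_or_compl_mem H h := by
    have h1 := σ.mem_or_compl_mem H h
    have h2 := τ.mem_or_compl_mem H h
    have h3 := ρ.mem_or_compl_mem H h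
    simp only [Set.mem_ofPred_eq]
    tauto
  not_mem_and_compl_mem H := by
    have h1 := σ.not_mem_and_compl_mem H
    have h2 := τ.not_mem_and_compl_mem H
    have h3 := ρ.not_mem_and_compl_mem H
    simp only [Set.mem_ofPred_eq]
    tauto
  mem_of_subset A B hA hB hAB := by
    have h1 := σ.mem_of_subset A B hA hB hAB
    have h2 := τ.mem_of_subset A B hA hB hAB
    have h3 := ρ.mem_of_subset A B hA hB hAB
    simp only [Set.mem_ofPred_eq]
    tauto

instance : MedianAlgebra (Orientation M) where
  med := maj
  med_self x y := by ext H; simp only [maj, Set.mem_ofPred_eq]; tauto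
  med_rotate x y z := by ext H; simp only [maj, Set.mem_ofPred_eq]; tauto
  med_swap x y z := by ext H; simp only [maj, Set.mem_ofPred_eq]; tauto
  med_assoc x y z w := by ext H; simp only [maj, Set.mem_ofPred_eq]; tauto

end Orientation

/-- The vertices of the cubulation of `M`: the orientations commensurable to the principal
orientations. -/
def cubulationVertices (M : Type*) [MedianAlgebra M] : Set (Orientation M) :=
  {σ | ∃ x : M, σ.Commensurable (Orientation.principal x)}

/-- The Roller boundary: the orientations that are not vertices of the cubulation. -/
def rollerBoundary (M : Type*) [MedianAlgebra M] : Set (Orientation M) :=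
  (cubulationVertices M)ᶜ

/-- The one-skeleton of the cubulation: two orientations are adjacent if their symmetric
difference has cardinality two. -/
def cubulation (M : Type*) [MedianAlgebra M] : SimpleGraph (cubulationVertices M) where
  Adj σ τ := (symmDiff σ.1.carrier τ.1.carrier).ncard = 2
  symm := ⟨fun σ τ h => by rwa [symmDiff_comm]⟩
  loopless := ⟨fun σ h => by simp at h⟩

/-- The one-skeleton of the `n`-cube. -/
def cubeGraph (n : ℕ) : SimpleGraph (Fin n → Bool) where
  Adj u v := hammingDist u v = 1
  symm := ⟨fun u v h => by rwa [hammingDist_comm]⟩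
  loopless := ⟨fun u h => by simp at h⟩

/-- The `n`-cubes of the cubulation fill in the subgraphs isomorphic to the one-skeleton of the
`n`-cube; `M` is finite-dimensional if the dimensions of these cubes are bounded. -/
def IsFiniteDimensional (M : Type*) [MedianAlgebra M] : Prop :=
  ∃ d : ℕ, ∀ n : ℕ, (cubeGraph n).IsContained (cubulation M) → n ≤ d

/-- A median flat: a non-empty, finite-dimensional, discrete median algebra which is included
into the interval between two points of its Roller boundary. -/
structure IsMedianFlat (M : Type*) [MedianAlgebra M] : Prop where
  nonempty : Nonempty M
  finiteDimensional : IsFiniteDimensional M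
  discrete : IsDiscrete M
  subset_interval : ∃ ζ ∈ rollerBoundary M, ∃ ξ ∈ rollerBoundary M,
    ∀ x : M, Orientation.principal x ∈ interval ζ ξ

/-- The isometry group of the cubulation of `M`, with respect to the combinatorial metric, i.e.
the graph metric of the one-skeleton. -/
def Isom (M : Type*) [MedianAlgebra M] : Subgroup (Equiv.Perm (cubulationVertices M)) where
  carrier := {g | ∀ x y, (cubulation M).dist (g x) (g y) = (cubulation M).dist x y}
  one_mem' _ _ := rfl
  mul_mem' {g h} hg hh x y := by
    rw [Equiv.Perm.mul_apply, Equiv.Perm.mul_apply, hg, hh]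
  inv_mem' {g} hg x y := by
    have := hg (g⁻¹ x) (g⁻¹ y)
    simpa using this.symm

section Elliptic

variable {M : Type*} [MedianAlgebra M]

/-- A group of isometries is elliptic if its orbits are bounded. -/
def IsEllipticSubgroup (K : Subgroup (Isom M)) : Prop :=
  ∀ x : cubulationVertices M, ∃ C : ℕ, ∀ g ∈ K, (cubulation M).dist x (g.1 x) ≤ C

/-- An isometry is elliptic if the orbits of the cyclic group that it generates are bounded. -/
def IsElliptic (g : Isom M) : Prop :=
  ∀ x : cubulationVertices M, ∃ C : ℕ, ∀ k : ℤ, (cubulation M).dist x ((g ^ k).1 x) ≤ C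

/-- A group of isometries is locally elliptic if its finitely generated subgroups are elliptic. -/
def IsLocallyElliptic (H : Subgroup (Isom M)) : Prop :=
  ∀ K : Subgroup (Isom M), K ≤ H → K.FG → IsEllipticSubgroup K

end Elliptic

end MedianAlgebra

/-! Every wall of the cubulation separates the two poles `ζ` and `ξ`, since a halfspace in both
would contain every point of `M`. Hence each wall has one side in `ζ`, and inclusion orders these
sides. An antichain of `n` of them spans an `n`-cube (`cubeGraph_isContained_of_antichain`), so the
dimension bounds the size of antichains. The argument uses only this and the finiteness of the
number of walls between two points; both are recorded in `FlatWallspace`.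

Call two halfspaces linked if a zigzag of inclusions joins them. Representatives of distinct classes
are incomparable, so there are finitely many classes, and their setwise stabilizers intersect in a
subgroup of finite index. On it, each class yields a homomorphism to `ℤ`: the number of its
halfspaces entered minus the number exited on the way from `x` to `g • x`. These are the coordinates
of `β`. An element with bounded orbits lies in the kernel, as the transfer of `g ^ k` is `k` times
that of `g`.

Conversely, let `β g = 1`. By the antichain bound a fixed power `k` of `g` moves each halfspace of
the pole to a comparable one. If it shrank one strictly, it would shrink its whole class
(`smul_ssubset_iff_of_subset`); then nothing in the class is exited from `x` to `k • x`, and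
transfer zero means that nothing is entered, which forces infinitely many walls between two points
(`not_pow_smul_ssubset`). So `k` fixes every halfspace, the kernel orbit of a halfspace of the pole
is an antichain, and kernel orbits of halfspaces are finite (`finite_orbit`). For a finitely
generated subgroup of the kernel, all walls between `x` and its translates then lie in one finite
invariant family (`locally_bounded`). -/

open scoped Pointwise

/-- A wallspace all of whose walls separate two opposite poles, of finite width. -/
structure FlatWallspace (V : Type*) where
  /-- the halfspaces -/
  halfspaces : Set (Set V)
  /-- the halfspaces on the side of one of the two poles -/
  pole : Set (Set V)
  pole_subset : pole ⊆ halfspaces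
  compl_mem : ∀ S ∈ halfspaces, Sᶜ ∈ halfspaces
  mem_pole_or_compl_mem : ∀ S ∈ halfspaces, S ∈ pole ∨ Sᶜ ∈ pole
  inter_nonempty : ∀ S ∈ pole, ∀ T ∈ pole, (S ∩ T).Nonempty
  compl_inter_nonempty : ∀ S ∈ pole, ∀ T ∈ pole, (Sᶜ ∩ Tᶜ).Nonempty
  finite_separating : ∀ x y, {S ∈ halfspaces | x ∈ S ∧ y ∉ S}.Finite
  /-- a bound on the cardinality of the antichains -/
  width : ℕ
  card_le_width : ∀ F : Finset (Set V), (F : Set (Set V)) ⊆ pole →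
    IsAntichain (· ⊆ ·) (F : Set (Set V)) → F.card ≤ width

namespace FlatWallspace

/-! ### Classes of linked halfspaces and their transfer -/

section Linked

variable {V : Type*} (W : FlatWallspace V)

/-- The equivalence relation generated by the inclusions between halfspaces. -/
def Linked : Set V → Set V → Prop :=
  Relation.EqvGen fun S T => S ∈ W.halfspaces ∧ T ∈ W.halfspaces ∧ S ⊆ T

variable {W}

theorem Linked.refl (S : Set V) : W.Linked S S := Relation.EqvGen.refl S

theorem Linked.symm {S T : Set V} (h : W.Linked S T) : W.Linked T S := Relation.EqvGen.symm _ _ h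

theorem Linked.trans {S T U : Set V} (h : W.Linked S T) (h' : W.Linked T U) : W.Linked S U :=
  Relation.EqvGen.trans _ _ _ h h'

theorem linked_of_subset {S T : Set V} (hS : S ∈ W.halfspaces) (hT : T ∈ W.halfspaces)
    (h : S ⊆ T) : W.Linked S T := Relation.EqvGen.rel _ _ ⟨hS, hT, h⟩

theorem Linked.iff_of_subset {p : Set V → Prop}
    (hp : ∀ S ∈ W.halfspaces, ∀ T ∈ W.halfspaces, S ⊆ T → (p S ↔ p T)) {S T : Set V}
    (h : W.Linked S T) : p S ↔ p T := by
  induction h with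
  | rel S T h => exact hp S h.1 T h.2.1 h.2.2
  | refl S => exact Iff.rfl
  | symm S T _ ih => exact ih.symm
  | trans S T U _ _ ih ih' => exact ih.trans ih'

/-- Off the halfspaces the generated relation is equality, so the class of a halfspace contains
nothing else. -/
theorem Linked.mem_halfspaces_iff {S T : Set V} (h : W.Linked S T) :
    S ∈ W.halfspaces ↔ T ∈ W.halfspaces :=
  h.iff_of_subset fun _ hS _ hT _ => iff_of_true hS hT

/-- If `S ⊆ T` were on different sides, `S` and `Tᶜ`, or `Sᶜ` and `T`, would both be in the pole,
against one of the two intersection axioms. So the two sides of a wall are never linked. -/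
theorem Linked.mem_pole_iff {S T : Set V} (h : W.Linked S T) : S ∈ W.pole ↔ T ∈ W.pole := by
  refine h.iff_of_subset fun S hS T hT hST => ⟨fun h => ?_, fun h => ?_⟩
  · refine (W.mem_pole_or_compl_mem T hT).resolve_right fun h' => ?_
    obtain ⟨x, hx, hx'⟩ := W.inter_nonempty S h _ h'
    exact hx' (hST hx)
  · refine (W.mem_pole_or_compl_mem S hS).resolve_right fun h' => ?_
    obtain ⟨x, hx, hx'⟩ := W.compl_inter_nonempty T h _ h'
    exact hx (hST (not_not.mp hx'))

theorem nonempty_of_mem_pole {S : Set V} (hS : S ∈ W.pole) : S.Nonempty := by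
  simpa using W.inter_nonempty S hS S hS

theorem compl_nonempty_of_mem_pole {S : Set V} (hS : S ∈ W.pole) : Sᶜ.Nonempty := by
  simpa using W.compl_inter_nonempty S hS S hS

theorem finite_of_isAntichain {A : Set (Set V)} (hA : A ⊆ W.pole)
    (h : IsAntichain (· ⊆ ·) A) : A.Finite := by
  by_contra hinf
  obtain ⟨F, hF, hcard⟩ := Set.Infinite.exists_subset_card_eq hinf (W.width + 1)
  have := W.card_le_width F (hF.trans hA) (h.subset hF)
  omega

variable (W)

/-- The classes of linked halfspaces. -/
def linkedSetoid : Setoid W.halfspaces where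
  r S T := W.Linked S T
  iseqv := ⟨fun S => .refl S.1, fun h => h.symm, fun h h' => h.trans h'⟩

/-- Representatives of distinct classes are incomparable: those in the pole form an antichain, and
so do the complements of the others. -/
instance finite_linked_classes : Finite (Quotient W.linkedSetoid) := by
  set r : Quotient W.linkedSetoid → Set V := fun c => (Quotient.out c).1 with hr
  have hmem c : r c ∈ W.halfspaces := (Quotient.out c).2
  have hinj c c' (h : W.Linked (r c) (r c')) : c = c' := by
    rw [← Quotient.out_eq c, ← Quotient.out_eq c']
    exact Quotient.sound h
  have h1 : {c | r c ∈ W.pole}.Finite := by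
    refine Set.Finite.of_finite_image (f := r) (W.finite_of_isAntichain ?_ ?_) ?_
    · rintro _ ⟨c, hc, rfl⟩
      exact hc
    · rintro _ ⟨c, hc, rfl⟩ _ ⟨c', hc', rfl⟩ hne hsub
      exact hne (congrArg r (hinj _ _ (linked_of_subset (hmem c) (hmem c') hsub)))
    · intro c _ c' _ h
      exact hinj _ _ (h ▸ Linked.refl _)
  have h2 : {c | (r c)ᶜ ∈ W.pole}.Finite := by
    refine Set.Finite.of_finite_image (f := fun c => (r c)ᶜ) (W.finite_of_isAntichain ?_ ?_) ?_
    · rintro _ ⟨c, hc, rfl⟩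
      exact hc
    · rintro _ ⟨c, hc, rfl⟩ _ ⟨c', hc', rfl⟩ hne hsub
      have := hinj _ _ (linked_of_subset (hmem c') (hmem c) (Set.compl_subset_compl.mp hsub))
      exact hne (congrArg (fun c => (r c)ᶜ) this.symm)
    · intro c _ c' _ h
      exact hinj _ _ (compl_injective h ▸ Linked.refl _)
  refine Set.finite_univ_iff.mp ((h1.union h2).subset fun c _ => ?_)
  exact W.mem_pole_or_compl_mem _ (hmem c)

/-- The signed number of the halfspaces linked to `S` that are crossed from `x` to `y`. -/
noncomputable def transfer (S : Set V) (x y : V) : ℤ :=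
  ∑ᶠ T ∈ {T | W.Linked S T}, (T.indicator 1 y - T.indicator 1 x)

variable {W}

theorem linked_inter_support_subset {S : Set V} (hS : S ∈ W.halfspaces) (x y : V) :
    {T | W.Linked S T} ∩ (Function.support fun T : Set V =>
      (T.indicator 1 y - T.indicator 1 x : ℤ)) ⊆
    {S ∈ W.halfspaces | x ∈ S ∧ y ∉ S} ∪ {S ∈ W.halfspaces | y ∈ S ∧ x ∉ S} := by
  rintro T ⟨hT, hne⟩
  have hT' := (Linked.mem_halfspaces_iff hT).mp hS
  by_cases hx : x ∈ T <;> by_cases hy : y ∈ T <;>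
    simp_all [Set.indicator, Function.mem_support]

/-- A `finsum` over an infinite support is 0 by default; this makes `transfer` a genuine count. -/
theorem finite_linked_inter_support {S : Set V} (hS : S ∈ W.halfspaces) (x y : V) :
    ({T | W.Linked S T} ∩ (Function.support fun T : Set V =>
      (T.indicator 1 y - T.indicator 1 x : ℤ))).Finite :=
  ((W.finite_separating x y).union (W.finite_separating y x)).subset
    (linked_inter_support_subset hS x y)

theorem transfer_add_transfer {S : Set V} (hS : S ∈ W.halfspaces) (x y z : V) :
    W.transfer S x y + W.transfer S y z = W.transfer S x z := by
  unfold transfer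
  rw [← finsum_mem_add_distrib' (finite_linked_inter_support hS x y)
    (finite_linked_inter_support hS y z)]
  refine finsum_mem_congr rfl fun T _ => ?_
  ring

theorem abs_transfer_le {S : Set V} (hS : S ∈ W.halfspaces) (x y : V) :
    |W.transfer S x y| ≤ {S ∈ W.halfspaces | x ∈ S ∧ y ∉ S}.ncard +
      {S ∈ W.halfspaces | y ∈ S ∧ x ∉ S}.ncard := by
  have hfin := finite_linked_inter_support hS x y
  have h1 : W.transfer S x y = ∑ T ∈ hfin.toFinset, (T.indicator 1 y - T.indicator 1 x) := by
    refine finsum_mem_eq_sum_of_inter_support_eq _ ?_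
    ext T
    simp
  have h2 : |W.transfer S x y| ≤ ∑ T ∈ hfin.toFinset, 1 := by
    rw [h1]
    refine (Finset.abs_sum_le_sum_abs _ _).trans (Finset.sum_le_sum fun T _ => ?_)
    by_cases hx : x ∈ T <;> by_cases hy : y ∈ T <;> simp [Set.indicator, hx, hy]
  refine h2.trans ?_
  rw [Finset.sum_const, nsmul_one, ← Set.ncard_eq_toFinset_card _ hfin]
  exact_mod_cast (Set.ncard_le_ncard (linked_inter_support_subset hS x y)
    ((W.finite_separating x y).union (W.finite_separating y x))).trans (Set.ncard_union_le _ _)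

/-- If no linked halfspace is exited from `x` to `y` and the transfer vanishes, then none is
entered either. -/
theorem mem_iff_of_transfer_eq_zero {S : Set V} (hS : S ∈ W.halfspaces) {x y : V}
    (hxy : ∀ T, W.Linked S T → x ∈ T → y ∈ T) (h : W.transfer S x y = 0) {T : Set V}
    (hT : W.Linked S T) : x ∈ T ↔ y ∈ T := by
  refine ⟨hxy T hT, fun hy => ?_⟩
  by_contra hx
  have hfin := finite_linked_inter_support hS x y
  have h1 : W.transfer S x y = ∑ T ∈ hfin.toFinset, (T.indicator 1 y - T.indicator 1 x) := by
    refine finsum_mem_eq_sum_of_inter_support_eq _ ?_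
    ext T
    simp
  rw [h1, Finset.sum_eq_zero_iff_of_nonneg] at h
  · have := h T (by simp [hT, hx, hy])
    simp [hx, hy] at this
  · intro T hT
    have hT' : W.Linked S T := ((Set.Finite.mem_toFinset _).mp hT).1
    by_cases hx : x ∈ T
    · simp [hx, hxy T hT' hx]
    · simp only [hx, not_false_eq_true, Set.indicator_of_notMem, sub_zero]
      exact Set.indicator_nonneg (by simp) _

end Linked

/-! ### Group actions: the transfer homomorphism and its kernel -/

section Action

variable {V : Type*} {W : FlatWallspace V} {G : Type*} [Group G] [MulAction G V]

theorem Linked.smul (hG : ∀ g : G, ∀ S ∈ W.halfspaces, g • S ∈ W.halfspaces) (g : G)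
    {S T : Set V} (h : W.Linked S T) : W.Linked (g • S) (g • T) := by
  induction h with
  | rel S T h =>
    exact linked_of_subset (hG g S h.1) (hG g T h.2.1) (Set.smul_set_mono h.2.2)
  | refl S => exact .refl _
  | symm S T _ ih => exact ih.symm
  | trans S T U _ _ ih ih' => exact ih.trans ih'

/-- The subgroup of the elements that preserve each class of linked halfspaces. -/
def linkStabilizer (hG : ∀ g : G, ∀ S ∈ W.halfspaces, g • S ∈ W.halfspaces) : Subgroup G where
  carrier := {g | ∀ S ∈ W.halfspaces, W.Linked S (g • S)}
  one_mem' S _ := by rw [one_smul]; exact .refl S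
  mul_mem' {g h} hg hh S hS := by
    rw [mul_smul]
    exact (hh S hS).trans (hg _ (hG h S hS))
  inv_mem' {g} hg S hS := by
    have := hg _ (hG g⁻¹ S hS)
    rw [smul_inv_smul] at this
    exact this.symm

/-- A coset is determined by the induced self-map of the finite set of classes. -/
theorem finiteIndex_linkStabilizer (hG : ∀ g : G, ∀ S ∈ W.halfspaces, g • S ∈ W.halfspaces) :
    (linkStabilizer hG).FiniteIndex := by
  let f : G → Quotient W.linkedSetoid → Quotient W.linkedSetoid := fun g c =>
    Quotient.mk _ ⟨g • (Quotient.out c).1, hG g _ (Quotient.out c).2⟩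
  have hf g g' (h : f g = f g') : g⁻¹ * g' ∈ linkStabilizer hG := by
    intro S hS
    have h1 := Quotient.exact (congrFun h (Quotient.mk _ ⟨S, hS⟩))
    have h2 : W.Linked (Quotient.out (Quotient.mk W.linkedSetoid ⟨S, hS⟩)).1 S :=
      Quotient.exact (Quotient.out_eq (Quotient.mk W.linkedSetoid ⟨S, hS⟩))
    have h3 : W.Linked (g • S) (g' • S) :=
      ((h2.smul hG g).symm.trans h1).trans (h2.smul hG g')
    have h4 := h3.smul hG g⁻¹
    rwa [inv_smul_smul, ← mul_smul] at h4
  have : Finite (G ⧸ linkStabilizer hG) := by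
    refine Finite.of_injective (fun q : G ⧸ linkStabilizer hG => f q.out) fun q q' h => ?_
    rw [← QuotientGroup.out_eq' q, ← QuotientGroup.out_eq' q']
    exact QuotientGroup.eq.mpr (hf _ _ h)
  exact Subgroup.finiteIndex_of_finite_quotient

theorem pow_smul_subset {g : G} {S : Set V} (h : g • S ⊆ S) (m : ℕ) : g ^ m • S ⊆ S := by
  induction m with
  | zero => simp
  | succ m ih =>
    rw [pow_succ, mul_smul]
    exact (Set.smul_set_mono h).trans ih

theorem subset_pow_smul {g : G} {S : Set V} (h : S ⊆ g • S) (m : ℕ) : S ⊆ g ^ m • S := by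
  induction m with
  | zero => simp
  | succ m ih =>
    rw [pow_succ, mul_smul]
    exact ih.trans (Set.smul_set_mono h)

theorem smul_ssubset_smul {g : G} {S T : Set V} (h : S ⊂ T) : g • S ⊂ g • T :=
  ⟨Set.smul_set_mono h.1, fun h' => h.2 (Set.smul_set_subset_smul_set_iff.mp h')⟩

theorem injective_pow_smul {g : G} {S : Set V} (h : g • S ⊂ S ∨ S ⊂ g • S) :
    Function.Injective fun m : ℕ => g ^ m • S := by
  rcases h with h | h
  · refine (strictAnti_nat_of_succ_lt fun m => ?_).injective
    rw [pow_succ, mul_smul]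
    exact smul_ssubset_smul h
  · refine (strictMono_nat_of_lt_succ fun m => ?_).injective
    rw [pow_succ, mul_smul]
    exact smul_ssubset_smul h

theorem not_separated_by_pow_smul (hG : ∀ g : G, ∀ S ∈ W.halfspaces, g • S ∈ W.halfspaces)
    {g : G} {S : Set V} (hS : S ∈ W.halfspaces) (h : g • S ⊂ S ∨ S ⊂ g • S) {x y : V}
    (hx : ∀ m : ℕ, x ∈ g ^ m • S) (hy : ∀ m : ℕ, y ∉ g ^ m • S) : False :=
  Set.infinite_of_injective_forall_mem (s := {S ∈ W.halfspaces | x ∈ S ∧ y ∉ S})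
    (injective_pow_smul h) (fun m => ⟨hG _ S hS, hx m, hy m⟩) (W.finite_separating x y)

theorem inv_smul_ssubset_iff {g : G} {S T : Set V} : g⁻¹ • S ⊂ T ↔ S ⊂ g • T := by
  constructor <;> intro h
  · simpa using smul_ssubset_smul (g := g) h
  · simpa using smul_ssubset_smul (g := g⁻¹) h

/-- Strict shrinking passes along inclusions, hence to whole classes. Otherwise take `x ∈ S` and `y
∉ T`: if `S` shrinks and `T` does not, the growing sets `g⁻¹ ^ m • S` contain `x` and stay inside
`T`; if `T` shrinks and `S` does not, the sets `g ^ m • T` contain `S` and miss `y`. Either way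
infinitely many halfspaces separate `x` from `y`. -/
theorem smul_ssubset_iff_of_subset
    (hG : ∀ g : G, ∀ S ∈ W.halfspaces, g • S ∈ W.halfspaces) {g : G}
    (hg : ∀ S ∈ W.pole, g • S ⊆ S ∨ S ⊆ g • S) {S T : Set V} (hS : S ∈ W.pole)
    (hT : T ∈ W.pole) (hST : S ⊆ T) : g • S ⊂ S ↔ g • T ⊂ T := by
  obtain ⟨x, hx⟩ := nonempty_of_mem_pole hS
  obtain ⟨y, hy⟩ := compl_nonempty_of_mem_pole hT
  have key (R : Set V) (hR : R ∈ W.pole) (hn : ¬ g • R ⊂ R) : R ⊆ g • R := by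
    rcases hg R hR with h | h
    · by_contra h'
      exact hn ⟨h, h'⟩
    · exact h
  constructor <;> intro h <;> by_contra hn
  · have h1 : g⁻¹ • T ⊆ T := Set.smul_set_subset_iff_subset_inv_smul_set.mpr
      (by simpa using key T hT hn)
    have h2 : S ⊆ g⁻¹ • S := Set.smul_set_subset_iff_subset_inv_smul_set.mp h.1
    have h3 : S ⊂ g⁻¹ • S := by
      rw [← inv_smul_ssubset_iff, inv_inv]; exact h
    exact not_separated_by_pow_smul hG (W.pole_subset hS) (Or.inr h3)
      (fun m => subset_pow_smul h2 m hx)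
      (fun m hm => hy (pow_smul_subset h1 m (Set.smul_set_mono hST hm)))
  · exact not_separated_by_pow_smul hG (W.pole_subset hT) (Or.inl h)
      (fun m => Set.smul_set_mono hST (subset_pow_smul (key S hS hn) m hx))
      (fun m hm => hy (pow_smul_subset h.1 m hm))

theorem smul_mem_pole (hG : ∀ g : G, ∀ S ∈ W.halfspaces, g • S ∈ W.halfspaces) {g : G}
    (hg : g ∈ linkStabilizer hG) {S : Set V} (hS : S ∈ W.pole) : g • S ∈ W.pole :=
  (Linked.mem_pole_iff (hg S (W.pole_subset hS))).mp hS

/-- Among the `width + 1` translates of `S` by `g ^ 0, …, g ^ width` two are comparable, so `g ^ k •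
S` is comparable to `S` for some `1 ≤ k ≤ width`. The factorial is a multiple of every such `k`,
which makes the exponent independent of `S`. -/
theorem pow_factorial_smul_comparable
    (hG : ∀ g : G, ∀ S ∈ W.halfspaces, g • S ∈ W.halfspaces) {g : G}
    (hg : g ∈ linkStabilizer hG) {S : Set V} (hS : S ∈ W.pole) :
    g ^ W.width.factorial • S ⊆ S ∨ S ⊆ g ^ W.width.factorial • S := by
  classical
  obtain ⟨k, hk0, hk, hcmp⟩ : ∃ k, 0 < k ∧ k ≤ W.width ∧ (g ^ k • S ⊆ S ∨ S ⊆ g ^ k • S) := by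
    by_contra! hcon
    have hlt i j (hij : i < j) (hj : j ≤ W.width) :
        ¬ g ^ i • S ⊆ g ^ j • S ∧ ¬ g ^ j • S ⊆ g ^ i • S := by
      obtain ⟨h1, h2⟩ := hcon (j - i) (by omega) (by omega)
      have : g ^ j = g ^ i * g ^ (j - i) := by rw [← pow_add]; congr 1; omega
      rw [this, mul_smul, Set.smul_set_subset_smul_set_iff, Set.smul_set_subset_smul_set_iff]
      exact ⟨h2, h1⟩
    have hne i j (hij : i ≠ j) (hi : i ≤ W.width) (hj : j ≤ W.width) :
        ¬ g ^ i • S ⊆ g ^ j • S := by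
      rcases hij.lt_or_gt with h | h
      · exact (hlt i j h hj).1
      · exact (hlt j i h hi).2
    have hinj : Set.InjOn (fun i : ℕ => g ^ i • S) (Finset.range (W.width + 1)) := by
      intro i hi j hj h
      by_contra hij
      simp only [Finset.coe_range, Set.mem_Iio] at hi hj
      exact hne i j hij (by omega) (by omega) (le_of_eq h)
    have := W.card_le_width ((Finset.range (W.width + 1)).image fun i : ℕ => g ^ i • S) ?_ ?_
    · rw [Finset.card_image_of_injOn hinj, Finset.card_range] at this
      omega
    · intro T hT
      obtain ⟨i, _, rfl⟩ := Finset.mem_image.mp (Finset.mem_coe.mp hT)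
      exact smul_mem_pole hG (pow_mem hg i) hS
    · intro T hT U hU hTU
      obtain ⟨i, hi, rfl⟩ := Finset.mem_image.mp (Finset.mem_coe.mp hT)
      obtain ⟨j, hj, rfl⟩ := Finset.mem_image.mp (Finset.mem_coe.mp hU)
      rw [Finset.mem_range] at hi hj
      exact hne i j (fun h => hTU (by rw [h])) (by omega) (by omega)
  obtain ⟨m, hm⟩ := Nat.dvd_factorial hk0 hk
  rw [hm, pow_mul]
  exact hcmp.imp (fun h => pow_smul_subset h m) (fun h => subset_pow_smul h m)

/-- An element of the stabilizer permutes the class, which reindexes the sum. With the cocycle rule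
`transfer_add_transfer` this makes the transfer a homomorphism. -/
theorem transfer_smul_smul (hG : ∀ g : G, ∀ S ∈ W.halfspaces, g • S ∈ W.halfspaces) {g : G}
    (hg : g ∈ linkStabilizer hG) {S : Set V} (hS : S ∈ W.halfspaces) (x y : V) :
    W.transfer S (g • x) (g • y) = W.transfer S x y := by
  refine (finsum_mem_eq_of_bijOn (fun T : Set V => g • T) ⟨?_, ?_, ?_⟩ ?_).symm
  · intro T hT
    exact Linked.trans hT (hg T ((Linked.mem_halfspaces_iff hT).mp hS))
  · exact (MulAction.injective g).injOn
  · intro T hT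
    refine ⟨g⁻¹ • T, ?_, smul_inv_smul g T⟩
    exact Linked.trans hT ((inv_mem hg) T ((Linked.mem_halfspaces_iff hT).mp hS))
  · intro T _
    have h z : z ∈ T ↔ g • z ∈ g • T := Set.smul_mem_smul_set_iff.symm
    by_cases hx : x ∈ T <;> by_cases hy : y ∈ T <;>
      simp [hx, hy, (h x).mp, (h y).mp, (h x).not.mp, (h y).not.mp]

/-- The transfer homomorphism of the class of the halfspaces linked to `S`. -/
noncomputable def transferHom (hG : ∀ g : G, ∀ S ∈ W.halfspaces, g • S ∈ W.halfspaces)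
    (S : W.halfspaces) (x : V) : linkStabilizer hG →* Multiplicative ℤ :=
  MonoidHom.mk' (fun g => Multiplicative.ofAdd (W.transfer S x (g.1 • x))) fun g h => by
    rw [← ofAdd_add]
    congr 1
    rw [← transfer_add_transfer S.2 x (g.1 • x), Subgroup.coe_mul, mul_smul,
      transfer_smul_smul hG g.2 S.2]

theorem Linked.transfer_eq {S T : Set V} (h : W.Linked S T) (x y : V) :
    W.transfer S x y = W.transfer T x y := by
  unfold transfer
  congr! 3 with U
  exact ⟨fun h' => h.symm.trans h', fun h' => h.trans h'⟩

/-- The homomorphism whose coordinates are the transfer homomorphisms of all the classes. -/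
noncomputable def totalTransfer (hG : ∀ g : G, ∀ S ∈ W.halfspaces, g • S ∈ W.halfspaces)
    (x : V) : linkStabilizer hG →*
      Multiplicative (Fin (Nat.card (Quotient W.linkedSetoid)) → ℤ) :=
  MonoidHom.mk' (fun g => Multiplicative.ofAdd fun i =>
    (transferHom hG (Quotient.out ((Finite.equivFin _).symm i)) x g).toAdd) fun g h => by
    rw [← ofAdd_add]
    congr 1
    funext i
    simp

theorem totalTransfer_eq_one_iff (hG : ∀ g : G, ∀ S ∈ W.halfspaces, g • S ∈ W.halfspaces)
    (x : V) (g : linkStabilizer hG) :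
    totalTransfer hG x g = 1 ↔ ∀ S ∈ W.halfspaces, W.transfer S x (g.1 • x) = 0 := by
  have h1 : totalTransfer hG x g = 1 ↔ ∀ i, W.transfer
      (Quotient.out ((Finite.equivFin (Quotient W.linkedSetoid)).symm i)).1 x (g.1 • x) = 0 :=
    funext_iff
  rw [h1]
  refine ⟨fun h S hS => ?_, fun h i => h _ (Subtype.prop _)⟩
  have h2 := h (Finite.equivFin _ (Quotient.mk W.linkedSetoid ⟨S, hS⟩))
  rw [Equiv.symm_apply_apply] at h2
  rw [← h2]
  exact (Linked.transfer_eq (Quotient.exact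
    (Quotient.out_eq (Quotient.mk W.linkedSetoid ⟨S, hS⟩))) _ _).symm

theorem not_pow_smul_ssubset (hG : ∀ g : G, ∀ S ∈ W.halfspaces, g • S ∈ W.halfspaces) (x : V)
    {g : linkStabilizer hG} (hg : totalTransfer hG x g = 1) {S : Set V} (hS : S ∈ W.pole) :
    ¬ g.1 ^ W.width.factorial • S ⊂ S := by
  intro h
  set k := g ^ W.width.factorial with hk
  have hk1 : totalTransfer hG x k = 1 := by rw [hk, map_pow, hg, one_pow]
  have hkg : (k : G) = g.1 ^ W.width.factorial := by simp [hk]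
  have hcmp : ∀ T ∈ W.pole, k.1 • T ⊆ T ∨ T ⊆ k.1 • T := fun T hT => by
    rw [hkg]; exact pow_factorial_smul_comparable hG g.2 hT
  rw [← hkg] at h
  have hS' := W.pole_subset hS
  have hall T (hT : W.Linked S T) : k.1 • T ⊂ T := by
    have h1 : (S ∈ W.pole ∧ k.1 • S ⊂ S) ↔ (T ∈ W.pole ∧ k.1 • T ⊂ T) := by
      refine Linked.iff_of_subset (p := fun S => S ∈ W.pole ∧ k.1 • S ⊂ S)
        (fun A hA B hB hAB => ?_) hT
      have h2 := Linked.mem_pole_iff (linked_of_subset hA hB hAB)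
      constructor <;> rintro ⟨h3, h4⟩
      · exact ⟨h2.mp h3, (smul_ssubset_iff_of_subset hG hcmp h3 (h2.mp h3) hAB).mp h4⟩
      · exact ⟨h2.mpr h3, (smul_ssubset_iff_of_subset hG hcmp (h2.mpr h3) h3 hAB).mpr h4⟩
    exact (h1.mp ⟨hS, h⟩).2
  -- All terms of the transfer are nonnegative because the whole class shrinks, so a zero sum kills
  -- each term. Applied to the translates of `S`, this keeps `x` on the same side of all of them.
  have hiff T (hT : W.Linked S T) : x ∈ T ↔ k.1 • x ∈ T :=
    mem_iff_of_transfer_eq_zero hS'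
      (fun T hT hx => (hall T hT).1 (Set.smul_mem_smul_set hx))
      ((totalTransfer_eq_one_iff hG x k).mp hk1 S hS') hT
  have hpow (m : ℕ) : W.Linked S (k.1 ^ m • S) := (pow_mem k.2 m : k.1 ^ m ∈ _) S hS'
  have hpow' (m : ℕ) : W.Linked S (k.1⁻¹ ^ m • S) :=
    (pow_mem (inv_mem k.2) m : k.1⁻¹ ^ m ∈ _) S hS'
  by_cases hx : x ∈ S
  · obtain ⟨y, hy⟩ := compl_nonempty_of_mem_pole hS
    refine not_separated_by_pow_smul hG hS' (Or.inl h) (x := x) (fun m => ?_)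
      (fun m hm => hy (pow_smul_subset h.1 m hm))
    induction m with
    | zero => simpa using hx
    | succ m ih =>
      rw [hiff _ (hpow _), pow_succ', mul_smul, Set.smul_mem_smul_set_iff]
      exact ih
  · obtain ⟨y, hy⟩ := nonempty_of_mem_pole hS
    have h3 : S ⊂ k.1⁻¹ • S := by
      rw [← inv_smul_ssubset_iff, inv_inv]; exact h
    refine not_separated_by_pow_smul hG hS' (Or.inr h3) (y := x)
      (fun m => subset_pow_smul h3.1 m hy) (fun m => ?_)
    induction m with
    | zero => simpa using hx
    | succ m ih =>
      rw [pow_succ', mul_smul, Set.mem_inv_smul_set_iff, ← hiff _ (hpow' _)]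
      exact ih

theorem pow_smul_eq (hG : ∀ g : G, ∀ S ∈ W.halfspaces, g • S ∈ W.halfspaces) (x : V)
    {g : linkStabilizer hG} (hg : totalTransfer hG x g = 1) {S : Set V} (hS : S ∈ W.pole) :
    g.1 ^ W.width.factorial • S = S := by
  have h1 := not_pow_smul_ssubset hG x hg hS
  have h2 := not_pow_smul_ssubset hG x (g := g⁻¹) (by rw [map_inv, hg, inv_one]) hS
  rw [Subgroup.coe_inv, inv_pow, inv_smul_ssubset_iff] at h2
  rcases pow_factorial_smul_comparable hG g.2 hS with h | h
  · by_contra hne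
    exact h1 (h.ssubset_of_ne hne)
  · by_contra hne
    exact h2 (h.ssubset_of_ne (Ne.symm hne))

/-- Some positive power of `g` fixes `S`, so the descending chain of translates returns to `S` and
is constant. -/
theorem smul_eq_of_subset (hG : ∀ g : G, ∀ S ∈ W.halfspaces, g • S ∈ W.halfspaces) (x : V)
    {g : linkStabilizer hG} (hg : totalTransfer hG x g = 1) {S : Set V} (hS : S ∈ W.pole)
    (h : g.1 • S ⊆ S) : g.1 • S = S := by
  refine h.antisymm ?_
  obtain ⟨m, hm⟩ := Nat.exists_eq_succ_of_ne_zero W.width.factorial_ne_zero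
  have h1 := pow_smul_eq hG x hg hS
  rw [hm, Nat.succ_eq_add_one, pow_succ', mul_smul] at h1
  conv_lhs => rw [← h1]
  exact Set.smul_set_mono (pow_smul_subset h m)

/-- For `S` in the pole, `g • S ⊆ h • S` gives `h⁻¹ * g` mapping `S` into itself, hence onto itself:
the orbit is an antichain. Complements cover the other halfspaces. -/
theorem finite_orbit (hG : ∀ g : G, ∀ S ∈ W.halfspaces, g • S ∈ W.halfspaces) (x : V)
    {S : Set V} (hS : S ∈ W.halfspaces) :
    {T | ∃ g : linkStabilizer hG, totalTransfer hG x g = 1 ∧ T = g.1 • S}.Finite := by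
  have key S (hS : S ∈ W.pole) :
      {T | ∃ g : linkStabilizer hG, totalTransfer hG x g = 1 ∧ T = g.1 • S}.Finite := by
    refine W.finite_of_isAntichain ?_ ?_
    · rintro _ ⟨g, _, rfl⟩
      exact smul_mem_pole hG g.2 hS
    · rintro _ ⟨g, hg, rfl⟩ _ ⟨h, hh, rfl⟩ hne hsub
      have h1 : (h⁻¹ * g).1 • S = S := by
        refine smul_eq_of_subset hG x (by rw [map_mul, map_inv, hg, hh, inv_one, one_mul]) hS ?_
        rw [Subgroup.coe_mul, Subgroup.coe_inv, mul_smul,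
          Set.smul_set_subset_iff_subset_inv_smul_set, inv_inv]
        exact hsub
      rw [Subgroup.coe_mul, Subgroup.coe_inv, mul_smul, inv_smul_eq_iff] at h1
      exact hne h1
  rcases W.mem_pole_or_compl_mem S hS with h | h
  · exact key S h
  · refine ((key _ h).image compl).subset ?_
    rintro _ ⟨g, hg, rfl⟩
    exact ⟨_, ⟨g, hg, rfl⟩, by rw [Set.smul_set_compl, compl_compl]⟩

theorem locally_bounded (hG : ∀ g : G, ∀ S ∈ W.halfspaces, g • S ∈ W.halfspaces) (o : V)
    {K : Subgroup G} (hK : K ≤ (totalTransfer hG o).ker.map (linkStabilizer hG).subtype)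
    (hfg : K.FG) (x : V) :
    ∃ C : ℕ, ∀ g ∈ K, {S ∈ W.halfspaces | x ∈ S ∧ g • x ∉ S}.ncard ≤ C := by
  obtain ⟨s, rfl⟩ := hfg
  have hmem g (hg : g ∈ Subgroup.closure (s : Set G)) :
      ∃ k : linkStabilizer hG, totalTransfer hG o k = 1 ∧ k.1 = g := by
    obtain ⟨k, hk, hkg⟩ := hK hg
    exact ⟨k, hk, hkg⟩
  set sep : V → V → Set (Set V) := fun x y =>
    {S ∈ W.halfspaces | x ∈ S ∧ y ∉ S} ∪ {S ∈ W.halfspaces | y ∈ S ∧ x ∉ S} with hsep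
  have hsepfin x y : (sep x y).Finite := (W.finite_separating x y).union (W.finite_separating y x)
  set A : Set (Set V) := ⋃ k ∈ s, sep x (k • x) with hA
  have hAfin : A.Finite := s.finite_toSet.biUnion fun k _ => hsepfin _ _
  set B : Set (Set V) := ⋃ S ∈ A,
    {T | ∃ g : linkStabilizer hG, totalTransfer hG o g = 1 ∧ T = g.1 • S} with hB
  have hBfin : B.Finite := hAfin.biUnion fun S hS => by
    refine finite_orbit hG o ?_
    simp only [hA, hsep, Set.mem_iUnion] at hS
    obtain ⟨k, _, h | h⟩ := hS
    exacts [h.1, h.1]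
  have hBsmul g (hg : g ∈ Subgroup.closure (s : Set G)) T (hT : T ∈ B) : g • T ∈ B := by
    obtain ⟨k, hk, rfl⟩ := hmem g hg
    simp only [hB, Set.mem_iUnion] at hT ⊢
    obtain ⟨S, hS, l, hl, rfl⟩ := hT
    exact ⟨S, hS, k * l, by rw [map_mul, hk, hl, one_mul],
      by rw [Subgroup.coe_mul, mul_smul]⟩
  -- Induction on words: a wall between `x` and `(g * h) • x` separates `x` from `g • x`, or is the
  -- `g`-translate of one between `x` and `h • x`; and `B` is invariant.
  have hsub g (hg : g ∈ Subgroup.closure (s : Set G)) : sep x (g • x) ⊆ B := by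
    induction hg using Subgroup.closure_induction with
    | mem k hk =>
      intro S hS
      simp only [hB, Set.mem_iUnion]
      exact ⟨S, by simp only [hA, Set.mem_iUnion]; exact ⟨k, hk, hS⟩, 1, map_one _, by simp⟩
    | one =>
      rintro S (⟨_, h, h'⟩ | ⟨_, h, h'⟩) <;> simp_all
    | mul g h hg hh ihg ihh =>
      intro S hS
      by_cases hS1 : S ∈ sep x (g • x)
      · exact ihg hS1
      · have h1 : g⁻¹ • S ∈ sep x (h • x) := by
          have hSh : S ∈ W.halfspaces := by rcases hS with h | h <;> exact h.1
          have := hG g⁻¹ S hSh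
          simp only [hsep, Set.mem_union, Set.mem_ofPred_eq, Set.mem_inv_smul_set_iff, hSh, this,
            true_and, mul_smul] at hS hS1 ⊢
          tauto
        simpa using hBsmul g hg _ (ihh h1)
    | inv g hg ih =>
      intro S hS
      have h1 : g • S ∈ sep x (g • x) := by
        have hSh : S ∈ W.halfspaces := by rcases hS with h | h <;> exact h.1
        have := hG g S hSh
        simp only [hsep, Set.mem_union, Set.mem_ofPred_eq, Set.mem_smul_set_iff_inv_smul_mem,
          hSh, this, true_and, inv_smul_smul] at hS ⊢
        tauto
      simpa using hBsmul g⁻¹ (inv_mem hg) _ (ih h1)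
  exact ⟨B.ncard, fun g hg => Set.ncard_le_ncard
    (Set.subset_union_left.trans (hsub g hg)) hBfin⟩

theorem totalTransfer_eq_one_of_bounded
    (hG : ∀ g : G, ∀ S ∈ W.halfspaces, g • S ∈ W.halfspaces) (o : V) (g : linkStabilizer hG)
    {C : ℕ} (h : ∀ k : ℤ, {S ∈ W.halfspaces | o ∈ S ∧ (g.1 ^ k) • o ∉ S}.ncard ≤ C)
    (h' : ∀ k : ℤ, {S ∈ W.halfspaces | (g.1 ^ k) • o ∈ S ∧ o ∉ S}.ncard ≤ C) :
    totalTransfer hG o g = 1 := by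
  rw [totalTransfer_eq_one_iff]
  intro S hS
  have hpow (k : ℕ) : W.transfer S o (g.1 ^ k • o) = k * W.transfer S o (g.1 • o) := by
    have h1 := congrArg Multiplicative.toAdd (map_pow (transferHom hG ⟨S, hS⟩ o) g k)
    rw [toAdd_pow, nsmul_eq_mul] at h1
    exact h1
  by_contra hne
  -- At most `C` halfspaces are crossed in each direction, so the transfer of any power is at most
  -- `2 * C` in absolute value; the exponent is the first to exceed this.
  have h1 := abs_transfer_le hS o (g.1 ^ (2 * C + 1) • o)
  rw [hpow, abs_mul] at h1
  have h2 := h (2 * C + 1 : ℕ)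
  have h3 := h' (2 * C + 1 : ℕ)
  rw [zpow_natCast] at h2 h3
  have h4 : 1 ≤ |W.transfer S o (g.1 • o)| := Int.one_le_abs hne
  have h5 : |((2 * C + 1 : ℕ) : ℤ)| = 2 * C + 1 := by rw [Nat.abs_cast]; push_cast; ring
  rw [h5] at h1
  have h6 : (2 * C + 1 : ℤ) * 1 ≤ (2 * C + 1) * |W.transfer S o (g.1 • o)| :=
    mul_le_mul_of_nonneg_left h4 (by positivity)
  omega

end Action

end FlatWallspace

/-! ### Halfspaces of a discrete median algebra -/

namespace MedianAlgebra

section Median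

variable {M : Type*} [MedianAlgebra M]

theorem med_comm_left (x y z : M) : med x y z = med y x z := by
  rw [med_rotate x y z, med_swap z x y, ← med_rotate y x z]

theorem med_mem_interval (x y z : M) : med x y z ∈ interval x y := by
  have h : med y x (med y x z) = med y x z := by
    rw [← med_assoc, med_comm_left y x y, med_self]
  change med x y (med x y z) = med x y z
  rw [med_comm_left x y, med_comm_left x y z, h]

theorem IsHalfspace.mem_iff_med_mem {H : Set M} (hH : IsHalfspace H) {x y : M} (hx : x ∈ H)
    (hy : y ∉ H) (z : M) : z ∈ H ↔ med x y z ∈ H := by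
  refine ⟨fun hz => hH.convex x hx z hz ?_, fun h => ?_⟩
  · rw [med_swap]
    exact med_mem_interval x z y
  · by_contra hz
    refine hH.convex_compl y hy z hz ?_ h
    rw [med_comm_left, med_swap]
    exact med_mem_interval y z x

/-- A halfspace separating `x` from `y` is determined by its trace on the finite interval, as `z`
and `med x y z` lie on the same side. -/
theorem IsDiscrete.finite_separating (hM : IsDiscrete M) (x y : M) :
    {H : Set M | IsHalfspace H ∧ x ∈ H ∧ y ∉ H}.Finite := by
  refine Set.Finite.of_finite_image (f := fun H => H ∩ interval x y)
    ((hM x y).finite_subsets.subset ?_) ?_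
  · rintro _ ⟨H, _, rfl⟩
    exact Set.inter_subset_right
  · rintro H ⟨hH, hx, hy⟩ K ⟨hK, hx', hy'⟩ h
    ext z
    have h1 := congrArg (fun S => med x y z ∈ S) h
    simp only [Set.mem_inter_iff, med_mem_interval, and_true, eq_iff_iff] at h1
    rw [hH.mem_iff_med_mem hx hy, h1, ← hK.mem_iff_med_mem hx' hy']

end Median

/-! ### The graph metric of the cubulation -/

namespace Orientation

variable {M : Type*} [MedianAlgebra M]

theorem compl_mem_iff (σ : Orientation M) {H : Set M} (hH : IsHalfspace H) :
    Hᶜ ∈ σ.carrier ↔ H ∉ σ.carrier :=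
  ⟨fun h h' => σ.not_mem_and_compl_mem H ⟨h', h⟩, (σ.mem_or_compl_mem H hH).resolve_left⟩

theorem mem_principal_iff {H : Set M} (hH : IsHalfspace H) (x : M) :
    H ∈ (principal x).carrier ↔ x ∈ H := and_iff_right hH

theorem diff_eq_image_compl (σ τ : Orientation M) :
    τ.carrier \ σ.carrier = compl '' (σ.carrier \ τ.carrier) := by
  ext H
  constructor
  · rintro ⟨h1, h2⟩
    have hH := τ.isHalfspace H h1
    exact ⟨Hᶜ, ⟨(σ.compl_mem_iff hH).mpr h2, fun h => τ.not_mem_and_compl_mem H ⟨h1, h⟩⟩,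
      compl_compl H⟩
  · rintro ⟨K, ⟨h1, h2⟩, rfl⟩
    exact ⟨(τ.compl_mem_iff (σ.isHalfspace K h1)).mpr h2,
      fun h => σ.not_mem_and_compl_mem K ⟨h1, h⟩⟩

theorem ncard_diff_comm (σ τ : Orientation M) :
    (τ.carrier \ σ.carrier).ncard = (σ.carrier \ τ.carrier).ncard := by
  rw [diff_eq_image_compl, Set.ncard_image_of_injective _ compl_injective]

theorem ncard_symmDiff {σ τ : Orientation M} (h : (σ.carrier \ τ.carrier).Finite) :
    (symmDiff σ.carrier τ.carrier).ncard = 2 * (σ.carrier \ τ.carrier).ncard := by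
  have h' : (τ.carrier \ σ.carrier).Finite := by
    rw [diff_eq_image_compl]
    exact h.image _
  rw [Set.symmDiff_def, Set.ncard_union_eq _ h h', ncard_diff_comm, two_mul]
  exact Set.disjoint_left.mpr fun H h1 h2 => h1.2 h2.1

theorem diff_subset_union (σ τ ρ : Orientation M) :
    σ.carrier \ ρ.carrier ⊆ (σ.carrier \ τ.carrier) ∪ (τ.carrier \ ρ.carrier) := by
  rintro H ⟨h1, h2⟩
  by_cases h : H ∈ τ.carrier
  exacts [Or.inr ⟨h, h2⟩, Or.inl ⟨h1, h⟩]

theorem finite_principal_diff (hM : IsDiscrete M) (x y : M) :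
    ((principal x).carrier \ (principal y).carrier).Finite :=
  (hM.finite_separating x y).subset fun _ h => ⟨h.1.1, h.1.2, fun hy => h.2 ⟨h.1.1, hy⟩⟩

theorem finite_diff (hM : IsDiscrete M) (σ τ : cubulationVertices M) :
    (σ.1.carrier \ τ.1.carrier).Finite := by
  obtain ⟨x, hx⟩ := σ.2
  obtain ⟨y, hy⟩ := τ.2
  rw [Commensurable, Set.symmDiff_def] at hx hy
  refine (((hx.subset Set.subset_union_left).union (finite_principal_diff hM x y)).union
    (hy.subset Set.subset_union_right)).subset ?_
  exact (diff_subset_union _ (principal y) _).trans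
    (Set.union_subset_union_left _ (diff_subset_union _ (principal x) _))

theorem mem_cubulationVertices_of_finite_diff {σ : Orientation M} {x : M}
    (h : (σ.carrier \ (principal x).carrier).Finite) : σ ∈ cubulationVertices M := by
  refine ⟨x, ?_⟩
  rw [Commensurable, Set.symmDiff_def, diff_eq_image_compl σ]
  exact h.union (h.image _)

/-- The vertex of the cubulation defined by a point. -/
def principalVertex (x : M) : cubulationVertices M :=
  ⟨principal x, mem_cubulationVertices_of_finite_diff (x := x) (by simp)⟩

theorem adj_iff (hM : IsDiscrete M) (σ τ : cubulationVertices M) :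
    (cubulation M).Adj σ τ ↔ (σ.1.carrier \ τ.1.carrier).ncard = 1 := by
  change (symmDiff σ.1.carrier τ.1.carrier).ncard = 2 ↔ _
  rw [ncard_symmDiff (finite_diff hM σ τ)]
  omega

/-- The orientation obtained by replacing a minimal halfspace by its complement. -/
def flip (σ : Orientation M) (H : Set M) (hH : H ∈ σ.carrier)
    (hmin : ∀ K ∈ σ.carrier, K ⊆ H → K = H) : Orientation M where
  carrier := {K | (K ∈ σ.carrier ∧ K ≠ H) ∨ K = Hᶜ}
  isHalfspace K h := by
    rcases h with h | rfl
    exacts [σ.isHalfspace K h.1, (σ.isHalfspace H hH).compl]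
  mem_or_compl_mem K hK := by
    by_cases h : K = H
    · exact Or.inr (Or.inr (h ▸ rfl))
    · by_cases h' : Kᶜ = H
      · exact Or.inl (Or.inr (by rw [← h', compl_compl]))
      · rcases σ.mem_or_compl_mem K hK with h1 | h1
        exacts [Or.inl (Or.inl ⟨h1, h⟩), Or.inr (Or.inl ⟨h1, h'⟩)]
  not_mem_and_compl_mem K := by
    rintro ⟨h1 | rfl, h2 | h2⟩
    · exact σ.not_mem_and_compl_mem K ⟨h1.1, h2.1⟩
    · exact h1.2 (compl_injective h2)
    · exact h2.2 (compl_compl H)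
    · obtain ⟨x, hx⟩ := (σ.isHalfspace H hH).nonempty
      rw [compl_compl] at h2
      have : x ∈ Hᶜ := h2 ▸ hx
      exact this hx
  mem_of_subset A B hA hB hAB h := by
    have hHs := σ.isHalfspace H hH
    rcases h with ⟨h1, h2⟩ | rfl
    · refine Or.inl ⟨σ.mem_of_subset A B hA hB hAB h1, ?_⟩
      rintro rfl
      exact h2 (hmin A h1 hAB)
    · by_cases h : B ∈ σ.carrier
      · refine Or.inl ⟨h, ?_⟩
        rintro rfl
        obtain ⟨x, hx⟩ := hHs.nonempty_compl
        exact hx (hAB hx)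
      · refine Or.inr ?_
        rw [← hmin _ ((σ.compl_mem_iff hB).mpr h) (Set.compl_subset_comm.mp hAB), compl_compl]

theorem exists_adj_step (hM : IsDiscrete M) {σ τ : cubulationVertices M} {n : ℕ}
    (h : (σ.1.carrier \ τ.1.carrier).ncard = n + 1) :
    ∃ ρ : cubulationVertices M, (cubulation M).Adj σ ρ ∧
      (ρ.1.carrier \ τ.1.carrier).ncard = n := by
  have hfin := finite_diff hM σ τ
  have hne : (σ.1.carrier \ τ.1.carrier).Nonempty :=
    (Set.ncard_pos hfin).mp (by omega)
  obtain ⟨H, ⟨hHσ, hHτ⟩, hmin⟩ := hfin.exists_minimal hne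
  have hHs := σ.1.isHalfspace H hHσ
  -- Minimality in the difference gives minimality in all of `σ`: if a smaller `K` were in `τ`, so
  -- would be `H`.
  have hmin' : ∀ K ∈ σ.1.carrier, K ⊆ H → K = H := fun K hK hKH =>
    hKH.antisymm (hmin ⟨hK, fun hKτ => hHτ (τ.1.mem_of_subset K H (σ.1.isHalfspace K hK) hHs
      hKH hKτ)⟩ hKH)
  set ρ := flip σ.1 H hHσ hmin' with hρ
  have hHne : H ≠ Hᶜ := by
    obtain ⟨x, hx⟩ := hHs.nonempty
    intro h
    have : x ∈ Hᶜ := h ▸ hx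
    exact this hx
  have h1 : σ.1.carrier \ ρ.carrier = {H} := by
    ext K
    constructor
    · rintro ⟨hK, hK'⟩
      by_contra hne
      exact hK' (Or.inl ⟨hK, hne⟩)
    · rintro rfl
      refine ⟨hHσ, ?_⟩
      rintro (h | h)
      exacts [h.2 rfl, hHne h]
  have h2 : ρ.carrier \ τ.1.carrier = (σ.1.carrier \ τ.1.carrier) \ {H} := by
    ext K
    constructor
    · rintro ⟨h | rfl, hK'⟩
      · exact ⟨⟨h.1, hK'⟩, h.2⟩
      · exact absurd ((τ.1.compl_mem_iff hHs).mpr hHτ) hK'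
    · rintro ⟨⟨h, h'⟩, hne⟩
      exact ⟨Or.inl ⟨h, hne⟩, h'⟩
  obtain ⟨y, hy⟩ := τ.2
  have hρV : ρ ∈ cubulationVertices M := by
    refine mem_cubulationVertices_of_finite_diff (x := y) ?_
    refine Set.Finite.subset ((hfin.subset ?_).union ?_) (diff_subset_union ρ τ.1 _)
    · rw [h2]
      exact Set.sdiff_subset
    · exact hy.subset (by rw [Set.symmDiff_def]; exact Set.subset_union_left)
  refine ⟨⟨ρ, hρV⟩, ?_, ?_⟩
  · rw [adj_iff hM, h1, Set.ncard_singleton]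
  · rw [h2, Set.ncard_sdiff_singleton_of_mem
      (show H ∈ σ.1.carrier \ τ.1.carrier from ⟨hHσ, hHτ⟩), h, Nat.add_sub_cancel]

theorem exists_walk (hM : IsDiscrete M) (n : ℕ) {σ τ : cubulationVertices M}
    (h : (σ.1.carrier \ τ.1.carrier).ncard = n) :
    ∃ w : (cubulation M).Walk σ τ, w.length = n := by
  induction n generalizing σ with
  | zero =>
    have h1 := (Set.ncard_eq_zero (finite_diff hM σ τ)).mp h
    have h2 := ncard_diff_comm σ.1 τ.1
    rw [h, Set.ncard_eq_zero (finite_diff hM τ σ)] at h2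
    have : σ = τ := Subtype.ext (Orientation.ext
      ((Set.sdiff_eq_empty.mp h1).antisymm (Set.sdiff_eq_empty.mp h2)))
    subst this
    exact ⟨.nil, rfl⟩
  | succ n ih =>
    obtain ⟨ρ, h1, h2⟩ := exists_adj_step hM h
    obtain ⟨w, hw⟩ := ih h2
    exact ⟨.cons h1 w, by simp [hw]⟩

theorem ncard_diff_le_length (hM : IsDiscrete M) {σ τ : cubulationVertices M}
    (w : (cubulation M).Walk σ τ) : (σ.1.carrier \ τ.1.carrier).ncard ≤ w.length := by
  induction w with
  | nil => simp
  | @cons σ ρ τ h w ih =>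
    have h1 := Set.ncard_le_ncard (diff_subset_union σ.1 ρ.1 τ.1)
      ((finite_diff hM σ ρ).union (finite_diff hM ρ τ))
    have h2 := Set.ncard_union_le (σ.1.carrier \ ρ.1.carrier) (ρ.1.carrier \ τ.1.carrier)
    rw [(adj_iff hM σ ρ).mp h] at h2
    rw [SimpleGraph.Walk.length_cons]
    omega

/-- Flipping minimal halfspaces of the difference gives a walk of this length, and each edge changes
one wall. The walk also rules out the default distance 0 between distinct components. -/
theorem dist_eq_ncard_diff (hM : IsDiscrete M) (σ τ : cubulationVertices M) :
    (cubulation M).dist σ τ = (σ.1.carrier \ τ.1.carrier).ncard := by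
  obtain ⟨w, hw⟩ := exists_walk hM _ (rfl : (σ.1.carrier \ τ.1.carrier).ncard = _)
  refine le_antisymm (hw ▸ SimpleGraph.dist_le w) ?_
  obtain ⟨w', hw'⟩ := w.reachable.exists_walk_length_eq_dist
  exact hw' ▸ ncard_diff_le_length hM w'

/-! ### Halfspaces of the cubulation and the action of isometries -/

/-- The set of the vertices of the cubulation that contain a halfspace. -/
def vertexHalfspace (H : Set M) : Set (cubulationVertices M) := {σ | H ∈ σ.1.carrier}

theorem principalVertex_mem_iff {H : Set M} (hH : IsHalfspace H) (x : M) :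
    principalVertex x ∈ vertexHalfspace H ↔ x ∈ H := mem_principal_iff hH x

theorem vertexHalfspace_compl {H : Set M} (hH : IsHalfspace H) :
    vertexHalfspace Hᶜ = (vertexHalfspace H)ᶜ :=
  Set.ext fun σ => σ.1.compl_mem_iff hH

theorem vertexHalfspace_mono {H K : Set M} (hH : IsHalfspace H) (hK : IsHalfspace K)
    (h : H ⊆ K) : vertexHalfspace H ⊆ vertexHalfspace K :=
  fun σ hσ => σ.1.mem_of_subset H K hH hK h hσ

theorem vertexHalfspace_injOn : Set.InjOn vertexHalfspace {H : Set M | IsHalfspace H} := by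
  intro H hH K hK h
  ext x
  rw [← principalVertex_mem_iff hH, h, principalVertex_mem_iff hK]

/-- A halfspace consists of the vertices that are closer to one end of a crossing edge. -/
theorem mem_vertexHalfspace_iff_dist_lt (hM : IsDiscrete M) {σ τ : cubulationVertices M}
    (h : (cubulation M).Adj σ τ) {H : Set M} (hσ : H ∉ σ.1.carrier) (hτ : H ∈ τ.1.carrier)
    (ρ : cubulationVertices M) :
    ρ ∈ vertexHalfspace H ↔ (cubulation M).dist ρ τ < (cubulation M).dist ρ σ := by
  have key (σ τ : cubulationVertices M) (h : (cubulation M).Adj σ τ) (H : Set M)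
      (hσ : H ∉ σ.1.carrier) (hτ : H ∈ τ.1.carrier) (hρ : H ∈ ρ.1.carrier) :
      (cubulation M).dist ρ τ < (cubulation M).dist ρ σ := by
    rw [dist_eq_ncard_diff hM, dist_eq_ncard_diff hM]
    have hHs := τ.1.isHalfspace H hτ
    obtain ⟨K, hK⟩ := Set.ncard_eq_one.mp ((adj_iff hM σ τ).mp h)
    have hHK : Hᶜ ∈ σ.1.carrier \ τ.1.carrier :=
      ⟨(σ.1.compl_mem_iff hHs).mpr hσ, fun h => τ.1.not_mem_and_compl_mem H ⟨hτ, h⟩⟩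
    rw [hK, Set.mem_singleton_iff] at hHK
    refine Set.ncard_lt_ncard ⟨?_, fun hsub => (hsub ⟨hρ, hσ⟩).2 hτ⟩ (finite_diff hM ρ σ)
    rintro L ⟨h1, h2⟩
    refine ⟨h1, fun h3 => ?_⟩
    have h4 : L ∈ σ.1.carrier \ τ.1.carrier := ⟨h3, h2⟩
    rw [hK, Set.mem_singleton_iff, ← hHK] at h4
    exact ρ.1.not_mem_and_compl_mem H ⟨hρ, h4 ▸ h1⟩
  refine ⟨fun hρ => key σ τ h H hσ hτ hρ, fun hlt => ?_⟩
  by_contra hρ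
  have hHs := τ.1.isHalfspace H hτ
  have := key τ σ h.symm Hᶜ (fun h => τ.1.not_mem_and_compl_mem H ⟨hτ, h⟩)
    ((σ.1.compl_mem_iff hHs).mpr hσ) ((ρ.1.compl_mem_iff hHs).mpr hρ)
  omega

theorem exists_crossing_edge (hM : IsDiscrete M) {H : Set M} (hH : IsHalfspace H) :
    ∃ σ τ : cubulationVertices M, (cubulation M).Adj σ τ ∧ H ∉ σ.1.carrier ∧
      H ∈ τ.1.carrier := by
  obtain ⟨x, hx⟩ := hH.nonempty
  obtain ⟨y, hy⟩ := hH.nonempty_compl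
  obtain ⟨w, -⟩ := exists_walk hM _ (rfl : ((principalVertex x).1.carrier \
    (principalVertex y).1.carrier).ncard = _)
  obtain ⟨d, -, h1, h2⟩ := w.exists_boundary_dart (vertexHalfspace H)
    ((principalVertex_mem_iff hH x).mpr hx) (fun h => hy ((principalVertex_mem_iff hH y).mp h))
  exact ⟨d.snd, d.fst, d.adj.symm, h2, h1⟩

/-- The description of a halfspace by distances to the ends of a crossing edge is metric, so the
image is the halfspace cut out by the image edge. -/
theorem exists_smul_vertexHalfspace_eq (hM : IsDiscrete M) (g : Isom M) {H : Set M}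
    (hH : IsHalfspace H) : ∃ K : Set M, IsHalfspace K ∧
      vertexHalfspace K = g • (vertexHalfspace H : Set (cubulationVertices M)) := by
  obtain ⟨σ, τ, hadj, hσ, hτ⟩ := exists_crossing_edge hM hH
  have hg (x y) : (cubulation M).dist (g • x) (g • y) = (cubulation M).dist x y := g.2 x y
  have hadj' : (cubulation M).Adj (g • σ) (g • τ) := by
    rw [← SimpleGraph.dist_eq_one_iff_adj, hg, SimpleGraph.dist_eq_one_iff_adj]
    exact hadj
  obtain ⟨K, hK⟩ := Set.ncard_eq_one.mp ((adj_iff hM _ _).mp hadj'.symm)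
  have hK' : K ∈ (g • τ).1.carrier \ (g • σ).1.carrier := hK ▸ rfl
  refine ⟨K, (g • τ).1.isHalfspace K hK'.1, ?_⟩
  ext ρ
  rw [mem_vertexHalfspace_iff_dist_lt hM hadj' hK'.2 hK'.1, Set.mem_smul_set_iff_inv_smul_mem,
    mem_vertexHalfspace_iff_dist_lt hM hadj hσ hτ, ← hg (g⁻¹ • ρ) τ, ← hg (g⁻¹ • ρ) σ,
    smul_inv_smul]

theorem setOf_separating_eq (σ τ : cubulationVertices M) :
    {S ∈ vertexHalfspace '' {H : Set M | IsHalfspace H} | σ ∈ S ∧ τ ∉ S} =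
      vertexHalfspace '' (σ.1.carrier \ τ.1.carrier) := by
  ext S
  constructor
  · rintro ⟨⟨H, hH, rfl⟩, h1, h2⟩
    exact ⟨H, ⟨h1, h2⟩, rfl⟩
  · rintro ⟨H, ⟨h1, h2⟩, rfl⟩
    exact ⟨⟨H, σ.1.isHalfspace H h1, rfl⟩, h1, h2⟩

theorem ncard_separating (hM : IsDiscrete M) (σ τ : cubulationVertices M) :
    {S ∈ vertexHalfspace '' {H : Set M | IsHalfspace H} | σ ∈ S ∧ τ ∉ S}.ncard =
      (cubulation M).dist σ τ := by
  rw [setOf_separating_eq, dist_eq_ncard_diff hM, Set.InjOn.ncard_image]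
  exact vertexHalfspace_injOn.mono fun H h => σ.1.isHalfspace H h.1

/-! ### Opposite poles: antichains span cubes -/

section Opposite

variable {ζ ξ : Orientation M}

/-- A halfspace in both `ζ` and `ξ` lies in their median with any principal orientation, so it would
contain every point. -/
theorem compl_mem_of_mem_interval [Nonempty M]
    (h : ∀ x : M, principal x ∈ interval ζ ξ) {H : Set M} (hH : H ∈ ζ.carrier) :
    Hᶜ ∈ ξ.carrier := by
  have hHs := ζ.isHalfspace H hH
  rw [ξ.compl_mem_iff hHs]
  intro hξ
  obtain ⟨x, hx⟩ := hHs.nonempty_compl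
  have h1 : maj ζ ξ (principal x) = principal x := h x
  have h2 : H ∈ (maj ζ ξ (principal x)).carrier := Or.inl ⟨hH, hξ⟩
  rw [h1] at h2
  exact hx h2.2

/-- If `ζ` and `ξ` are opposite, every up-closed subset of `ζ` is the trace of an orientation. -/
def ofUpperSet (hopp : ∀ H ∈ ζ.carrier, Hᶜ ∈ ξ.carrier) (U : Set (Set M)) (hU : U ⊆ ζ.carrier)
    (hup : ∀ A ∈ U, ∀ B ∈ ζ.carrier, A ⊆ B → B ∈ U) : Orientation M where
  carrier := {H | H ∈ U ∨ (Hᶜ ∈ ζ.carrier ∧ Hᶜ ∉ U)}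
  isHalfspace H h := by
    rcases h with h | h
    · exact ζ.isHalfspace H (hU h)
    · exact compl_compl H ▸ (ζ.isHalfspace _ h.1).compl
  mem_or_compl_mem H hH := by
    simp only [Set.mem_ofPred_eq, compl_compl]
    have := ζ.mem_or_compl_mem H hH
    tauto
  not_mem_and_compl_mem H := by
    simp only [Set.mem_ofPred_eq, compl_compl]
    have h1 := ζ.not_mem_and_compl_mem H
    have h2 := @hU H
    have h3 := @hU Hᶜ
    tauto
  mem_of_subset A B hA hB hAB h := by
    rcases h with h | ⟨h1, h2⟩
    · exact Or.inl (hup A h B (ζ.mem_of_subset A B hA hB hAB (hU h)) hAB)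
    · rcases ζ.mem_or_compl_mem B hB with h | h
      · refine absurd ⟨ξ.mem_of_subset A B hA hB hAB ?_, hopp B h⟩ (ξ.not_mem_and_compl_mem B)
        simpa using hopp _ h1
      · exact Or.inr ⟨h, fun hBU => h2 (hup _ hBU _ h1 (Set.compl_subset_compl.mpr hAB))⟩

theorem ncard_symmDiff_ofUpperSet (hopp : ∀ H ∈ ζ.carrier, Hᶜ ∈ ξ.carrier) {U U' : Set (Set M)}
    (hU : U ⊆ ζ.carrier) (hup : ∀ A ∈ U, ∀ B ∈ ζ.carrier, A ⊆ B → B ∈ U)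
    (hU' : U' ⊆ ζ.carrier) (hup' : ∀ A ∈ U', ∀ B ∈ ζ.carrier, A ⊆ B → B ∈ U') {H : Set M}
    (hH : H ∈ U) (h : ∀ K, K ∈ U' ↔ K ∈ U ∧ K ≠ H) :
    (symmDiff (ofUpperSet hopp U hU hup).carrier
      (ofUpperSet hopp U' hU' hup').carrier).ncard = 2 := by
  have h1 : (ofUpperSet hopp U hU hup).carrier \ (ofUpperSet hopp U' hU' hup').carrier = {H} := by
    ext K
    constructor
    · rintro ⟨h1 | h1, h2⟩
      · by_contra hne
        exact h2 (Or.inl ((h K).mpr ⟨h1, hne⟩))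
      · exact absurd (Or.inr ⟨h1.1, fun h3 => h1.2 ((h _).mp h3).1⟩) h2
    · rintro rfl
      refine ⟨Or.inl hH, ?_⟩
      rintro (h1 | h1)
      · exact ((h K).mp h1).2 rfl
      · exact ζ.not_mem_and_compl_mem K ⟨hU hH, h1.1⟩
  rw [ncard_symmDiff (by rw [h1]; exact Set.finite_singleton H), h1, Set.ncard_singleton]

theorem cubeGraph_isContained_of_antichain (hM : IsDiscrete M) (x : M)
    (hopp : ∀ H ∈ ζ.carrier, Hᶜ ∈ ξ.carrier) {n : ℕ} (H : Fin n → Set M)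
    (hH : ∀ i, H i ∈ ζ.carrier) (hanti : ∀ i j, H i ⊆ H j → i = j) :
    (cubeGraph n).IsContained (cubulation M) := by
  -- An up-closed set in which all the `H i` are minimal, so any subfamily can be removed
  -- independently; this gives the `2 ^ n` vertices of the cube. The clause on `x` keeps them
  -- commensurable to `principal x`.
  set U : Set (Set M) := {K | K ∈ ζ.carrier ∧ (x ∈ K ∨ ∃ i, H i ⊆ K) ∧ ∀ i, ¬ K ⊂ H i} with hUdef
  set T : (Fin n → Bool) → Set (Set M) := fun ε => {K ∈ U | ∀ i, ε i = true → K ≠ H i} with hTdef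
  have hT ε : T ε ⊆ ζ.carrier := fun K hK => hK.1.1
  have hup ε : ∀ A ∈ T ε, ∀ B ∈ ζ.carrier, A ⊆ B → B ∈ T ε := by
    rintro A ⟨⟨hA, hA1, hA2⟩, hA3⟩ B hB hAB
    refine ⟨⟨hB, ?_, fun i hi => hA2 i (hAB.trans_ssubset hi)⟩, fun i hi hBi => ?_⟩
    · rcases hA1 with h | ⟨i, h⟩
      exacts [Or.inl (hAB h), Or.inr ⟨i, h.trans hAB⟩]
    · subst hBi
      exact hA2 i (hAB.ssubset_of_ne (hA3 i hi))
  have hHU i : H i ∈ U := ⟨hH i, Or.inr ⟨i, subset_rfl⟩, fun j hj => by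
    have := hanti i j hj.1
    subst this
    exact hj.2 subset_rfl⟩
  have hHinj i j (h : H i = H j) : i = j := hanti i j h.le
  have hHT ε i : H i ∈ T ε ↔ ε i = false := by
    refine ⟨fun h => ?_, fun h => ⟨hHU i, fun j hj hij => ?_⟩⟩
    · have := h.2 i
      simpa using this
    · rw [hHinj i j hij] at h
      simp [h] at hj
  have hfin ε : ((ofUpperSet hopp (T ε) (hT ε) (hup ε)).carrier \
      (principal x).carrier).Finite := by
    -- A halfspace of the new orientation that misses `x` contains some `H i`, or contains the
    -- complement of some `H i`, possibly with equality; the points `a i` and `b i` turn these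
    -- inclusions into separation from `x`.
    choose a ha using fun i => (ζ.isHalfspace _ (hH i)).nonempty
    choose b hb using fun i => (ζ.isHalfspace _ (hH i)).nonempty_compl
    have h1 : (⋃ i, {K : Set M | IsHalfspace K ∧ a i ∈ K ∧ x ∉ K}).Finite :=
      Set.finite_iUnion fun i => hM.finite_separating _ _
    have h2 : (⋃ i, {K : Set M | IsHalfspace K ∧ b i ∈ K ∧ x ∉ K}).Finite :=
      Set.finite_iUnion fun i => hM.finite_separating _ _
    have h3 : (Set.range fun i => (H i)ᶜ).Finite := Set.finite_range _
    refine ((h1.union h2).union h3).subset ?_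
    rintro K ⟨hK | ⟨hK, hK'⟩, hKx⟩
    · have hKs := ζ.isHalfspace K (hT ε hK)
      rw [mem_principal_iff hKs] at hKx
      obtain ⟨i, hi⟩ := hK.1.2.1.resolve_left hKx
      exact Or.inl (Or.inl (Set.mem_iUnion.mpr ⟨i, hKs, hi (ha i), hKx⟩))
    · have hKs : IsHalfspace K := compl_compl K ▸ (ζ.isHalfspace _ hK).compl
      rw [mem_principal_iff hKs] at hKx
      by_cases h4 : ∃ i, Kᶜ ⊂ H i
      · obtain ⟨i, hi⟩ := h4
        refine Or.inl (Or.inr (Set.mem_iUnion.mpr ⟨i, hKs, ?_, hKx⟩))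
        by_contra h5
        exact hb i (hi.1 h5)
      · refine Or.inr ?_
        have h5 : Kᶜ ∈ U := ⟨hK, Or.inl hKx, fun i hi => h4 ⟨i, hi⟩⟩
        by_contra h6
        refine hK' ⟨h5, fun i _ h7 => h6 ⟨i, ?_⟩⟩
        simp [← h7]
  let f : (Fin n → Bool) → cubulationVertices M := fun ε =>
    ⟨ofUpperSet hopp (T ε) (hT ε) (hup ε), mem_cubulationVertices_of_finite_diff (hfin ε)⟩
  have hstep ε ε' i (h : ∀ j, j ≠ i → ε j = ε' j) (h1 : ε i = false) (h2 : ε' i = true) :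
      (cubulation M).Adj (f ε) (f ε') := by
    refine ncard_symmDiff_ofUpperSet hopp (hT ε) (hup ε) (hT ε') (hup ε')
      ((hHT ε i).mpr h1) fun K => ?_
    constructor
    · rintro ⟨hK, hK'⟩
      refine ⟨⟨hK, fun j hj => hK' j ?_⟩, hK' i h2⟩
      rw [← h j, hj]
      rintro rfl
      simp [h1] at hj
    · rintro ⟨⟨hK, hK'⟩, hne⟩
      refine ⟨hK, fun j hj => ?_⟩
      by_cases hji : j = i
      · rwa [hji]
      · exact hK' j ((h j hji).trans hj)
  refine ⟨⟨⟨f, @fun ε ε' h => ?_⟩, fun ε ε' h => ?_⟩⟩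
  · obtain ⟨i, hi⟩ := Finset.card_eq_one.mp (show hammingDist ε ε' = 1 from h)
    have h1 j (hj : j ≠ i) : ε j = ε' j := by
      by_contra h2
      have : j ∈ Finset.univ.filter fun j => ε j ≠ ε' j := by simp [h2]
      rw [hi, Finset.mem_singleton] at this
      exact hj this
    have h2 : ε i ≠ ε' i := by
      have : i ∈ Finset.univ.filter fun j => ε j ≠ ε' j := by rw [hi]; simp
      simpa using this
    cases h3 : ε i with
    | false => exact hstep ε ε' i h1 h3 (by simpa [h3] using h2)
    | true =>
      exact (hstep ε' ε i (fun j hj => (h1 j hj).symm) (by simpa [h3] using h2) h3).symm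
  · funext i
    have h1 ε : H i ∈ (f ε).1.carrier ↔ ε i = false := by
      rw [← hHT]
      refine ⟨fun h => h.resolve_right fun h' => ?_, Or.inl⟩
      exact ζ.not_mem_and_compl_mem _ ⟨hH i, h'.1⟩
    have h2 : ε i = false ↔ ε' i = false := by
      rw [← h1, ← h1]
      exact iff_of_eq (congrArg (fun σ : cubulationVertices M => H i ∈ σ.1.carrier) h)
    cases h3 : ε i <;> cases h4 : ε' i <;> simp_all

theorem inter_nonempty_of_mem (σ : Orientation M) {H K : Set M} (hH : H ∈ σ.carrier)
    (hK : K ∈ σ.carrier) : (H ∩ K).Nonempty := by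
  have hKs := σ.isHalfspace K hK
  by_contra h
  refine σ.not_mem_and_compl_mem K ⟨hK, σ.mem_of_subset H Kᶜ (σ.isHalfspace H hH) hKs.compl ?_ hH⟩
  exact fun x hx hx' => h ⟨x, hx, hx'⟩

/-- The wallspace of the vertices of the cubulation of a median flat. -/
def flatWallspace (hM : IsDiscrete M) (x : M) (hopp : ∀ H ∈ ζ.carrier, Hᶜ ∈ ξ.carrier) (d : ℕ)
    (hd : ∀ n, (cubeGraph n).IsContained (cubulation M) → n ≤ d) :
    FlatWallspace (cubulationVertices M) where
  halfspaces := vertexHalfspace '' {H | IsHalfspace H}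
  pole := vertexHalfspace '' ζ.carrier
  pole_subset := Set.image_mono fun H hH => ζ.isHalfspace H hH
  compl_mem := by
    rintro _ ⟨H, hH, rfl⟩
    exact ⟨Hᶜ, IsHalfspace.compl hH, vertexHalfspace_compl hH⟩
  mem_pole_or_compl_mem := by
    rintro _ ⟨H, hH, rfl⟩
    rw [← vertexHalfspace_compl hH]
    exact (ζ.mem_or_compl_mem H hH).imp (Set.mem_image_of_mem _) (Set.mem_image_of_mem _)
  inter_nonempty := by
    rintro _ ⟨H, hH, rfl⟩ _ ⟨K, hK, rfl⟩
    obtain ⟨y, h1, h2⟩ := ζ.inter_nonempty_of_mem hH hK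
    exact ⟨principalVertex y, (principalVertex_mem_iff (ζ.isHalfspace H hH) y).mpr h1,
      (principalVertex_mem_iff (ζ.isHalfspace K hK) y).mpr h2⟩
  compl_inter_nonempty := by
    rintro _ ⟨H, hH, rfl⟩ _ ⟨K, hK, rfl⟩
    obtain ⟨y, h1, h2⟩ := ξ.inter_nonempty_of_mem (hopp H hH) (hopp K hK)
    exact ⟨principalVertex y, fun h => h1 ((principalVertex_mem_iff (ζ.isHalfspace H hH) y).mp h),
      fun h => h2 ((principalVertex_mem_iff (ζ.isHalfspace K hK) y).mp h)⟩
  finite_separating σ τ := by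
    rw [setOf_separating_eq]
    exact (finite_diff hM σ τ).image _
  width := d
  card_le_width F hF hanti := by
    choose H hH hHF using fun i : Fin F.card => hF (F.equivFin.symm i).2
    refine hd _ (cubeGraph_isContained_of_antichain hM x hopp H hH fun i j hij => ?_)
    by_contra hne
    refine hanti (F.equivFin.symm i).2 (F.equivFin.symm j).2 ?_ ?_
    · exact fun h => hne (F.equivFin.symm.injective (Subtype.ext h))
    · rw [← hHF, ← hHF]
      exact vertexHalfspace_mono (ζ.isHalfspace _ (hH i)) (ζ.isHalfspace _ (hH j)) hij

end Opposite

end Orientation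

end MedianAlgebra

/-! ### The proposition -/

open MedianAlgebra Orientation in
theorem mainTheorem9 (M : Type*) [MedianAlgebra M] (hM : MedianAlgebra.IsMedianFlat M) :
    ∃ (Isom₀ : Subgroup (MedianAlgebra.Isom M)) (n : ℕ)
      (β : Isom₀ →* Multiplicative (Fin n → ℤ)),
      Isom₀.FiniteIndex ∧ 1 ≤ n ∧
      (β.ker : Set Isom₀) = {g : Isom₀ | MedianAlgebra.IsElliptic (g : MedianAlgebra.Isom M)} ∧
      MedianAlgebra.IsLocallyElliptic (β.ker.map Isom₀.subtype) := by
  obtain ⟨hne, ⟨d, hd⟩, hdisc, ζ, hζ, ξ, -, hint⟩ := hM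
  obtain ⟨x⟩ := id hne
  have hopp : ∀ H ∈ ζ.carrier, Hᶜ ∈ ξ.carrier := fun H hH => compl_mem_of_mem_interval hint hH
  set W := flatWallspace hdisc x hopp d hd with hW
  have hdist (σ τ : cubulationVertices M) :
      {S ∈ W.halfspaces | σ ∈ S ∧ τ ∉ S}.ncard = (cubulation M).dist σ τ :=
    ncard_separating hdisc σ τ
  have hG : ∀ g : Isom M, ∀ S ∈ W.halfspaces, g • S ∈ W.halfspaces := by
    rintro g _ ⟨H, hH, rfl⟩
    obtain ⟨K, hK, h⟩ := exists_smul_vertexHalfspace_eq hdisc g hH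
    exact ⟨K, hK, h⟩
  have hloc : IsLocallyElliptic ((FlatWallspace.totalTransfer hG (principalVertex x)).ker.map
      (FlatWallspace.linkStabilizer hG).subtype) := by
    intro K hK hfg σ
    obtain ⟨C, hC⟩ := FlatWallspace.locally_bounded hG _ hK hfg σ
    exact ⟨C, fun g hg => (hdist σ (g • σ)).symm.le.trans (hC g hg)⟩
  refine ⟨FlatWallspace.linkStabilizer hG, _, FlatWallspace.totalTransfer hG (principalVertex x),
    FlatWallspace.finiteIndex_linkStabilizer hG, ?_, ?_, hloc⟩
  -- The rank is the number of classes. Without halfspaces, `ζ` would coincide with a principal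
  -- orientation, although it is in the boundary.
  · have : Nonempty (Quotient W.linkedSetoid) := by
      by_contra hempty
      refine hζ (mem_cubulationVertices_of_finite_diff (x := x) ?_)
      convert Set.finite_empty
      refine Set.eq_empty_of_forall_notMem fun H hH => hempty ⟨Quotient.mk _ ⟨_, H, ?_, rfl⟩⟩
      exact ζ.isHalfspace H hH.1
    exact Nat.card_pos
  · ext g
    constructor
    · intro hg σ
      obtain ⟨C, hC⟩ := hloc (Subgroup.zpowers g.1)
        (by rw [Subgroup.zpowers_le]; exact ⟨g, hg, rfl⟩)
        ((Subgroup.fg_iff _).mpr ⟨{g.1}, (Subgroup.zpowers_eq_closure _).symm,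
          Set.finite_singleton _⟩) σ
      exact ⟨C, fun k => hC _ ⟨k, rfl⟩⟩
    · intro hg
      obtain ⟨C, hC⟩ := hg (principalVertex x)
      refine FlatWallspace.totalTransfer_eq_one_of_bounded hG _ g (C := C) (fun k => ?_)
        (fun k => ?_)
      · rw [hdist]
        exact hC k
      · rw [hdist, SimpleGraph.dist_comm]
        exact hC k
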